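/- Let $k$ be a commutative artinian ring, $\Lambda$ an artin $k$-algebra (finitely generated as a $k$-module), $E$ an injective envelope of $k/\operatorname{rad}k$, $D=\operatorname{Hom}_k(-,E)$, and $\Delta=\{e_1,\dots,e_n\}$ a complete set of primitive orthogonal idempotents of $\Lambda$. All modules are finitely generated left modules, and all subcategories are full and closed under isomorphism. For an ideal $I$, $\Lambda/I\text{-mod}$ is viewed as a subcategory of $\Lambda\text{-mod}$. For an artin algebra $\Gamma$, $\mathcal P(\Gamma)$ and $\mathcal I(\Gamma)$ denote the finitely generated projective and the finitely generated injective $\Gamma$-modules. A torsion pair on a subcategory $\mathcal C$ of $\Lambda\text{-mod}$ is a pair $(\mathcal T,\mathcal F)$ of subcategories of $\mathcal C$ such that $\operatorname{Hom}(X,Y)=0$ for $X\in\mathcal T$, $Y\in\mathcal F$, and each $X\in\mathcal C$ has an exact sequence $0\to A\to X\to B\to 0$ with $A\in\mathcal T$, $B\in\mathcal F$. Let $(\mathcal T,\mathcal F)$ be a torsion pair on $\Lambda\text{-mod}$. A left-hand decomposition of it is a sequence $\Delta_0,\dots,\Delta_m$ of pairwise disjoint subsets of $\Delta$, with $\Delta_1,\dots,\Delta_m$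 nonempty, such that the following holds. Put $\varepsilon^{i}=\sum_{e\in\Delta_0\cup\dots\cup\Delta_{i}}e$, $\Lambda^0=\Lambda$, $\Lambda^{i+1}=\Lambda/\Lambda\varepsilon^{i}\Lambda$, $P_i=\bigoplus_{e\in\Delta_i}\Lambda^ie$, $I_i=\bigoplus_{e\in\Delta_i}D(e\Lambda^i)$, $\mathcal T^0=\mathcal T$, $\mathcal F^0=\mathcal F$. * If $i\le m$ is even, then $\mathcal T^i\cap\mathcal P(\Lambda^i)=\operatorname{add}P_i$, and one sets $\mathcal T^{i+1}=\{M\in\mathcal T^i:\operatorname{Hom}_\Lambda(P_i,M)=0\}$, $\mathcal F^{i+1}=\mathcal F^i$. * If $i\le m$ is odd, then $\mathcal F^i\cap\mathcal I(\Lambda^i)=\operatorname{add}I_i$, and one sets $\mathcal T^{i+1}=\mathcal T^i$, $\mathcal F^{i+1}=\{M\in\mathcal F^i:\operatorname{Hom}_\Lambda(M,I_i)=0\}$. * $\mathcal T^{m+1}\cap\mathcal P(\Lambda^{m+1})=\{0\}=\mathcal F^{m+1}\cap\mathcal I(\Lambda^{m+1})$. The residual torsion pair is $(\mathcal T^{m+1},\mathcal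 F^{m+1})$. A right-hand decomposition is defined in the same way with the words "even" and "odd" interchanged, so that it starts with injective modules. Theorem. Let $\Delta'_0,\dots,\Delta'_u$ be a left-hand decomposition and $\Delta''_0,\dots,\Delta''_v$ a right-hand decomposition of the same torsion pair $(\mathcal T,\mathcal F)$ on $\Lambda\text{-mod}$. Let $(\mathcal T',\mathcal F')$ and $(\mathcal T'',\mathcal F'')$ be their residual torsion pairs, $\Lambda/I'$ and $\Lambda/I''$ their last algebras, $\Delta'=\bigcup_i\Delta'_i$ and $\Delta''=\bigcup_i\Delta''_i$. Then $I'=I''$ and $(\mathcal T',\mathcal F')=(\mathcal T'',\mathcal F'')$, and this is a torsion pair on $\Lambda/I'\text{-mod}$. Moreover, $\{\Lambda e:e\in\Delta'\}$ and $\{\Lambda e:e\in\Delta''\}$ coincide up to isomorphism of their members. If $\Delta'$ and $\Delta''$ each contain with an $e$ all $f\in\Delta$ such that $\Lambda f\cong\Lambda e$ (this is automatic if $\Lambda$ is basic), then $\Delta'=\Delta''$. -/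

import Mathlib

open CategoryTheory

universe u

namespace TorsionDecomposition

section Injectives

variable (k : Type u) [CommRing k]

/-- `E` is an injective envelope of the `k`-module `V`: it is injective, and `V` embeds into it
as an essential submodule. -/
def IsInjectiveEnvelope (V E : Type u) [AddCommGroup V] [Module k V]
    [AddCommGroup E] [Module k E] : Prop :=
  Module.Injective k E ∧ ∃ ι : V →ₗ[k] E, Function.Injective ι ∧
    ∀ N : Submodule k E, N ≠ ⊥ → N ⊓ LinearMap.range ι ≠ ⊥

variable {R : Type u} [Ring R] [Algebra k R]

/-- The right ideal `xR` of a `k`-algebra `R`, as a `k`-module. -/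
def rightIdeal (x : R) : Submodule k R := LinearMap.range (LinearMap.mulLeft k x)

/-- Right multiplication by `a` on the right ideal `xR`. -/
def rightMul (x a : R) : rightIdeal k x →ₗ[k] rightIdeal k x :=
  (LinearMap.mulRight k a).restrict (by
    rintro _ ⟨y, rfl⟩
    exact ⟨y * a, by simp [mul_assoc]⟩)

@[simp] theorem rightMul_coe (x a : R) (y : rightIdeal k x) :
    (rightMul k x a y : R) = (y : R) * a := rfl

/-- `D(xR) = Hom_k(xR, E)`. -/
def DualRight (E : Type u) [AddCommGroup E] [Module k E] (x : R) : Type u :=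
  rightIdeal k x →ₗ[k] E

variable (E : Type u) [AddCommGroup E] [Module k E] (x : R)

instance : AddCommGroup (DualRight k E x) :=
  inferInstanceAs (AddCommGroup (rightIdeal k x →ₗ[k] E))

instance : FunLike (DualRight k E x) (rightIdeal k x) E :=
  inferInstanceAs (FunLike (rightIdeal k x →ₗ[k] E) (rightIdeal k x) E)

instance : LinearMapClass (DualRight k E x) k (rightIdeal k x) E :=
  inferInstanceAs (LinearMapClass (rightIdeal k x →ₗ[k] E) k (rightIdeal k x) E)

/-- The action of `R` on `D(xR)` from the left: `(a • φ)(y) = φ(y a)`. -/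
instance : SMul R (DualRight k E x) where
  smul a φ := LinearMap.comp (φ : rightIdeal k x →ₗ[k] E) (rightMul k x a)

variable {k E x} in
theorem DualRight.ext {φ ψ : DualRight k E x}
    (h : ∀ y : rightIdeal k x, φ y = ψ y) : φ = ψ :=
  LinearMap.ext h

theorem DualRight.smul_apply (a : R) (φ : DualRight k E x) (y : rightIdeal k x) :
    (a • φ) y = φ (rightMul k x a y) := rfl

instance : Module R (DualRight k E x) where
  one_smul φ := DualRight.ext fun y => by
    have h : rightMul k x 1 y = y := Subtype.ext (mul_one (y : R))
    rw [DualRight.smul_apply, h]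
  mul_smul a b φ := DualRight.ext fun y => by
    have h : rightMul k x (a * b) y = rightMul k x b (rightMul k x a y) :=
      Subtype.ext (mul_assoc (y : R) a b).symm
    rw [DualRight.smul_apply, h]
    rfl
  smul_zero _ := rfl
  smul_add _ _ _ := rfl
  add_smul a b φ := DualRight.ext fun y => by
    have h : rightMul k x (a + b) y = rightMul k x a y + rightMul k x b y :=
      Subtype.ext (mul_add (y : R) a b)
    rw [DualRight.smul_apply, h]
    exact map_add φ _ _
  zero_smul φ := DualRight.ext fun y => by
    have h : rightMul k x 0 y = 0 := Subtype.ext (mul_zero (y : R))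
    rw [DualRight.smul_apply, h]
    exact map_zero φ

end Injectives

section Subcategories

variable {Λ : Type u} [Ring Λ]

/-- `x` is a primitive idempotent: a nonzero idempotent that is not the sum of two nonzero
orthogonal idempotents. -/
def IsPrimitiveIdempotent (x : Λ) : Prop :=
  IsIdempotentElem x ∧ x ≠ 0 ∧
    ∀ a b : Λ, IsIdempotentElem a → IsIdempotentElem b → a * b = 0 → b * a = 0 →
      x = a + b → a = 0 ∨ b = 0

/-- A torsion pair `(T, F)` on a full subcategory `C` of the category of `Λ`-modules. -/
structure IsTorsionPair (C T F : ObjectProperty (ModuleCat.{u} Λ)) : Prop where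
  torsion_le : T ≤ C
  torsionFree_le : F ≤ C
  torsion_iso : T.IsClosedUnderIsomorphisms
  torsionFree_iso : F.IsClosedUnderIsomorphisms
  hom_eq_zero : ∀ X Y : ModuleCat.{u} Λ, T X → F Y → ∀ f : X →ₗ[Λ] Y, f = 0
  exists_exact : ∀ X : ModuleCat.{u} Λ, C X →
    ∃ (A B : ModuleCat.{u} Λ) (f : A →ₗ[Λ] X) (g : X →ₗ[Λ] B), T A ∧ F B ∧
      Function.Injective f ∧ Function.Exact f g ∧ Function.Surjective g

/-- `add P`: the modules isomorphic to a direct summand of a finite direct sum of copies of `P`. -/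
def addClosure (P : ModuleCat.{u} Λ) : ObjectProperty (ModuleCat.{u} Λ) := fun M =>
  ∃ (r : ℕ) (i : M →ₗ[Λ] (Fin r → P)) (p : (Fin r → P) →ₗ[Λ] M), p ∘ₗ i = LinearMap.id

/-- The finitely generated `Λ`-modules. -/
def fgModules (Λ : Type u) [Ring Λ] : ObjectProperty (ModuleCat.{u} Λ) := fun M =>
  Module.Finite Λ M

/-- Restriction of scalars along `Λ → Λ/I`. -/
noncomputable abbrev restrict (I : TwoSidedIdeal Λ) (N : ModuleCat.{u} (Λ ⧸ I.asIdeal)) :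
    ModuleCat.{u} Λ :=
  (ModuleCat.restrictScalars (Ideal.Quotient.mk I.asIdeal)).obj N

/-- The finitely generated `Λ/I`-modules, as a subcategory of the category of `Λ`-modules. -/
def quotModules (I : TwoSidedIdeal Λ) : ObjectProperty (ModuleCat.{u} Λ) := fun M =>
  ∃ N : ModuleCat.{u} (Λ ⧸ I.asIdeal),
    Module.Finite (Λ ⧸ I.asIdeal) N ∧ Nonempty (M ≅ restrict I N)

/-- The finitely generated projective `Λ/I`-modules. -/
def quotProjectives (I : TwoSidedIdeal Λ) : ObjectProperty (ModuleCat.{u} Λ) := fun M =>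
  ∃ N : ModuleCat.{u} (Λ ⧸ I.asIdeal), Module.Finite (Λ ⧸ I.asIdeal) N ∧
    Module.Projective (Λ ⧸ I.asIdeal) N ∧ Nonempty (M ≅ restrict I N)

/-- The finitely generated injective `Λ/I`-modules. -/
def quotInjectives (I : TwoSidedIdeal Λ) : ObjectProperty (ModuleCat.{u} Λ) := fun M =>
  ∃ N : ModuleCat.{u} (Λ ⧸ I.asIdeal), Module.Finite (Λ ⧸ I.asIdeal) N ∧
    Module.Injective (Λ ⧸ I.asIdeal) N ∧ Nonempty (M ≅ restrict I N)

end Subcategories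

section Decomposition

variable {Λ : Type u} [Ring Λ] {n : ℕ} (e : Fin n → Λ)

/-- The indices occurring in `Δ 0, …, Δ (i - 1)`. -/
def usedBefore (Δ : ℕ → Finset (Fin n)) (i : ℕ) : Finset (Fin n) :=
  (Finset.range i).biUnion Δ

/-- The ideal `Λ ε Λ`, where `ε` is the sum of all `e j` with `j` in `Δ 0, …, Δ (i - 1)`.
The `i`-th algebra of the decomposition is the quotient of `Λ` by it. -/
def stageIdeal (Δ : ℕ → Finset (Fin n)) (i : ℕ) : TwoSidedIdeal Λ :=
  TwoSidedIdeal.span {∑ j ∈ usedBefore Δ i, e j}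

/-- The `i`-th algebra `Λ^i` of the decomposition. -/
abbrev StageAlg (Δ : ℕ → Finset (Fin n)) (i : ℕ) : Type u :=
  Λ ⧸ (stageIdeal e Δ i).asIdeal

/-- `P_i`, the direct sum of the left `Λ^i`-modules `Λ^i (e j)` over `j ∈ Δ i`. -/
noncomputable def stageProj (Δ : ℕ → Finset (Fin n)) (i : ℕ) : ModuleCat.{u} Λ :=
  restrict (stageIdeal e Δ i) (ModuleCat.of (StageAlg e Δ i)
    ((j : Δ i) → Ideal.span {Ideal.Quotient.mk (stageIdeal e Δ i).asIdeal (e j)}))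

variable (k : Type u) [CommRing k] [Algebra k Λ] (E : Type u) [AddCommGroup E] [Module k E]

/-- `I_i`, the direct sum of the left `Λ^i`-modules `D((e j) Λ^i)` over `j ∈ Δ i`. -/
noncomputable def stageInj (Δ : ℕ → Finset (Fin n)) (i : ℕ) : ModuleCat.{u} Λ :=
  restrict (stageIdeal e Δ i) (ModuleCat.of (StageAlg e Δ i)
    ((j : Δ i) → DualRight k E (Ideal.Quotient.mk (stageIdeal e Δ i).asIdeal (e j))))

/-- The classes `T^i`; `projStep i` says that at step `i` projective modules are split off
(otherwise injective ones are). Here `T^(i+1)` is `T^i ∩ (P_i)^⊥` at a projective step and `T^i`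
at an injective step. -/
def stageTorsion (T : ObjectProperty (ModuleCat.{u} Λ)) (projStep : ℕ → Prop)
    (Δ : ℕ → Finset (Fin n)) : ℕ → ObjectProperty (ModuleCat.{u} Λ)
  | 0 => T
  | i + 1 => fun M => stageTorsion T projStep Δ i M ∧
      (projStep i → ∀ f : stageProj e Δ i →ₗ[Λ] M, f = 0)

/-- The classes `F^i`: here `F^(i+1)` is `F^i` at a projective step and `F^i ∩ ^⊥(I_i)` at an
injective step. -/
def stageTorsionFree (F : ObjectProperty (ModuleCat.{u} Λ)) (projStep : ℕ → Prop)
    (Δ : ℕ → Finset (Fin n)) : ℕ → ObjectProperty (ModuleCat.{u} Λ)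
  | 0 => F
  | i + 1 => fun M => stageTorsionFree F projStep Δ i M ∧
      (¬ projStep i → ∀ f : M →ₗ[Λ] stageInj e k E Δ i, f = 0)

/-- `Δ 0, …, Δ m` is the sequence of sets of idempotents produced by decomposing `(T, F)`, where
projectives are split off at the steps with `projStep` and injectives at the others. A finite
sequence is encoded by a sequence that is empty from `m + 1` on. The last field says that nothing
is left to be split off from `(T^(m+1), F^(m+1))` over `Λ^(m+1)`. -/
structure IsDecomposition (T F : ObjectProperty (ModuleCat.{u} Λ)) (projStep : ℕ → Prop)
    (m : ℕ) (Δ : ℕ → Finset (Fin n)) : Prop where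
  disjoint : ∀ i j, i ≠ j → Disjoint (Δ i) (Δ j)
  nonempty : ∀ i, 1 ≤ i → i ≤ m → (Δ i).Nonempty
  eq_empty : ∀ i, m < i → Δ i = ∅
  proj_step : ∀ i, i ≤ m → projStep i →
    stageTorsion e T projStep Δ i ⊓ quotProjectives (stageIdeal e Δ i) =
      addClosure (stageProj e Δ i)
  inj_step : ∀ i, i ≤ m → ¬ projStep i →
    stageTorsionFree e k E F projStep Δ i ⊓ quotInjectives (stageIdeal e Δ i) =
      addClosure (stageInj e k E Δ i)
  residual_zero : ∀ M : ModuleCat.{u} Λ,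
    (stageTorsion e T projStep Δ (m + 1) M ∧ quotProjectives (stageIdeal e Δ (m + 1)) M ∨
      stageTorsionFree e k E F projStep Δ (m + 1) M ∧
        quotInjectives (stageIdeal e Δ (m + 1)) M) → Subsingleton M

/-- The decomposition that starts with projectives: these are split off at the even steps. -/
abbrev IsLeftDecomposition (T F : ObjectProperty (ModuleCat.{u} Λ)) (m : ℕ)
    (Δ : ℕ → Finset (Fin n)) : Prop :=
  IsDecomposition e k E T F Even m Δ

/-- The decomposition that starts with injectives: these are split off at the even steps. -/
abbrev IsRightDecomposition (T F : ObjectProperty (ModuleCat.{u} Λ)) (m : ℕ)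
    (Δ : ℕ → Finset (Fin n)) : Prop :=
  IsDecomposition e k E T F Odd m Δ

/-- The projective modules `Λ (e i)` and `Λ (e j)` are isomorphic. -/
def IsoProj (i j : Fin n) : Prop :=
  Nonempty (Ideal.span {e i} ≃ₗ[Λ] Ideal.span {e j})

/-- `A` contains, with an index `i`, every `j` such that `Λ (e j)` is isomorphic to `Λ (e i)`. If
`Λ` is basic, that is, if no two of the `Λ (e i)` are isomorphic, every set has this property. -/
def IsoClosed (A : Finset (Fin n)) : Prop :=
  ∀ i j, i ∈ A → IsoProj e i j → j ∈ A

end Decomposition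

end TorsionDecomposition

/-! Whatever its kind, a step of a decomposition has one and the same effect: it cuts both classes
down to the modules annihilated by the `e j` it splits off. For `M` over `Λ^i`, `Hom(P_i, M)` and
`Hom(M, I_i)` each vanish exactly when these `e j` kill `M` (`forall_hom_stageProj_eq_zero_iff`,
`forall_hom_stageInj_eq_zero_iff`). A projective step restricts only the torsion class by
definition, but `P_i` is torsion, so the torsion-free modules already satisfy the condition;
injective steps are dual. Hence `T^i` and `F^i` are the members of `T` and `F` over `Λ^i`
(`stageTorsion_and_stageTorsionFree_iff`).

It remains to compare the last ideals. Let `J'` be the last ideal of one decomposition and suppose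
it contains the `i`-th ideal of another. If `e j` is split off there as a projective, then `(Λ/J')(e
j)` is a quotient of `P_i`, hence torsion, and it is projective over `Λ/J'`. Nothing of this kind is
left in the residual pair, so it is zero and `e j ∈ J'`. Injectives are dual, with submodules of
`I_i`. Induction and symmetry give equal ideals (`stageIdeal_le_stageIdeal`), hence equal residual
pairs. Finally, the ideal determines the isomorphism classes of the `Λ(e j)` split off, because each
`Λ(e j)` has a greatest proper submodule (`mem_stageIdeal_iff_exists_isoProj`). -/

namespace TorsionDecomposition

/-! ### Indecomposable modules of finite length and projectivity -/

section LocalModules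

variable {R M : Type*} [Ring R] [AddCommGroup M] [Module R M]

/-- A module without nontrivial direct sum decompositions. -/
def HasNoDecomposition (R M : Type*) [Ring R] [AddCommGroup M] [Module R M] : Prop :=
  ∀ N N' : Submodule R M, IsCompl N N' → N = ⊥ ∨ N' = ⊥

/-- Fitting's lemma for modules of finite length without nontrivial decompositions. -/
theorem HasNoDecomposition.isNilpotent_or_isUnit [IsArtinian R M] [IsNoetherian R M]
    (hM : HasNoDecomposition R M) (φ : Module.End R M) : IsNilpotent φ ∨ IsUnit φ := by
  -- The bound `1 ≤ n` is what allows passing from `φ ^ n` being a unit back to `φ`.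
  obtain ⟨n, hn, hc⟩ := ((Filter.eventually_ge_atTop 1).and
    φ.eventually_isCompl_ker_pow_range_pow).exists
  rcases hM _ _ hc with h | h
  · right
    rw [← isUnit_pow_iff (n := n) (by omega), Module.End.isUnit_iff]
    refine ⟨LinearMap.ker_eq_bot.mp h, LinearMap.range_eq_top.mp ?_⟩
    simpa [h] using hc.sup_eq_top
  · exact Or.inl ⟨n, LinearMap.range_eq_bot.mp h⟩

/-- In a projective module of finite length without nontrivial decompositions, the sum of two
proper submodules is proper. -/
theorem HasNoDecomposition.eq_top_or_eq_top [IsArtinian R M] [IsNoetherian R M]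
    [Module.Projective R M] (hM : HasNoDecomposition R M) {N N' : Submodule R M}
    (h : N ⊔ N' = ⊤) : N = ⊤ ∨ N' = ⊤ := by
  have hsurj : Function.Surjective (N.subtype.coprod N'.subtype) := by
    rw [← LinearMap.range_eq_top, LinearMap.range_coprod]
    simpa using h
  -- A section of `N × N' → M` writes the identity as `φ + ψ` with images in `N` and `N'`. If `φ` is
  -- nilpotent, `ψ = 1 - φ` is a unit, and the image of a unit is everything.
  obtain ⟨s, hs⟩ := Module.projective_lifting_property _ LinearMap.id hsurj
  let φ : Module.End R M := N.subtype ∘ₗ LinearMap.fst R N N' ∘ₗ s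
  let ψ : Module.End R M := N'.subtype ∘ₗ LinearMap.snd R N N' ∘ₗ s
  have hadd : φ + ψ = 1 := by
    ext x
    exact LinearMap.congr_fun hs x
  have key : IsUnit φ ∨ IsUnit ψ := by
    rcases hM.isNilpotent_or_isUnit φ with h | h
    · right
      rw [← eq_sub_iff_add_eq'] at hadd
      rw [hadd]
      exact h.isUnit_one_sub
    · exact Or.inl h
  refine key.imp (fun h => ?_) (fun h => ?_) <;> rw [eq_top_iff] <;> rintro x - <;>
    obtain ⟨y, rfl⟩ := ((Module.End.isUnit_iff _).mp h).2 x
  · exact (s y).1.2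
  · exact (s y).2.2

/-- A proper submodule not below a given coatom would span the whole module together with it,
although both are proper. -/
theorem HasNoDecomposition.exists_greatest_proper [IsArtinian R M] [IsNoetherian R M]
    [Module.Projective R M] [Nontrivial M] (hM : HasNoDecomposition R M) :
    ∃ N₀ : Submodule R M, N₀ ≠ ⊤ ∧ ∀ N : Submodule R M, N ≠ ⊤ → N ≤ N₀ := by
  obtain ⟨N₀, h₀, -⟩ := (eq_top_or_exists_le_coatom (⊥ : Submodule R M)).resolve_left bot_ne_top
  refine ⟨N₀, h₀.1, fun N hN => ?_⟩
  by_contra hle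
  have := h₀.2 (N₀ ⊔ N) (left_lt_sup.mpr hle)
  exact (hM.eq_top_or_eq_top this).elim h₀.1 hN

/-- A section `s` of `f` splits `M` into the image of `s`, nonzero because `P` is, and the kernel of
`f`, which must therefore vanish. -/
theorem HasNoDecomposition.bijective_of_surjective {P : Type*} [AddCommGroup P] [Module R P]
    [Module.Projective R P] [Nontrivial P] (hM : HasNoDecomposition R M) {f : M →ₗ[R] P}
    (hf : Function.Surjective f) : Function.Bijective f := by
  obtain ⟨s, hs⟩ := Module.projective_lifting_property f LinearMap.id hf
  have hs' (y : P) : f (s y) = y := LinearMap.congr_fun hs y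
  have hproj : ∀ x : LinearMap.range s, (s.rangeRestrict ∘ₗ f) x = x := by
    rintro ⟨_, y, rfl⟩
    ext
    simp [hs']
  rcases hM _ _ (LinearMap.isCompl_of_proj hproj) with h | h
  · obtain ⟨x, hx⟩ := exists_ne (0 : P)
    rw [LinearMap.range_eq_bot] at h
    exact absurd (by simpa [h] using (hs' x).symm) hx
  · refine ⟨LinearMap.ker_eq_bot.mp (eq_bot_iff.mpr ?_), hf⟩
    rw [← h]
    intro x hx
    have hx : f x = 0 := hx
    ext
    simp [hx]

end LocalModules

/-! ### Primitive idempotents and the left ideals they generate -/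

section Idempotents

variable {Λ : Type u} [Ring Λ]

theorem projective_span_singleton {x : Λ} (hx : IsIdempotentElem x) :
    Module.Projective Λ (Ideal.span {x}) := by
  refine Module.Projective.of_split (Submodule.subtype _)
    ((LinearMap.toSpanSingleton Λ Λ x).codRestrict (Ideal.span {x}) fun a =>
      Ideal.mem_span_singleton'.mpr ⟨a, rfl⟩) ?_
  ext ⟨y, hy⟩
  obtain ⟨a, rfl⟩ := Ideal.mem_span_singleton'.mp hy
  simp [mul_assoc, hx.eq]

theorem IsPrimitiveIdempotent.nontrivial {x : Λ} (hx : IsPrimitiveIdempotent x) :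
    Nontrivial (Ideal.span {x}) :=
  ⟨⟨x, Ideal.mem_span_singleton_self x⟩, 0, fun h => hx.2.1 (congrArg Subtype.val h)⟩

/-- The components `a`, `b` of `x` in `N ⊕ N'` are orthogonal idempotents with sum `x`. One of them
vanishes, so the generator `x` lies in the other summand. -/
theorem IsPrimitiveIdempotent.hasNoDecomposition {x : Λ} (hx : IsPrimitiveIdempotent x) :
    HasNoDecomposition Λ (Ideal.span {x}) := by
  intro N N' hN
  have gen (K : Submodule Λ (Ideal.span {x}))
      (h : (⟨x, Ideal.mem_span_singleton_self x⟩ : Ideal.span {x}) ∈ K) : K = ⊤ := by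
    rw [eq_top_iff]
    rintro ⟨y, hy⟩ -
    obtain ⟨a, rfl⟩ := Ideal.mem_span_singleton'.mp hy
    exact K.smul_mem a h
  have mulx (y : Ideal.span {x}) : (y : Λ) * x = y := by
    obtain ⟨y, hy⟩ := y
    obtain ⟨a, rfl⟩ := Ideal.mem_span_singleton'.mp hy
    simp [mul_assoc, hx.1.eq]
  obtain ⟨a, ha, b, hb, hab⟩ := Submodule.mem_sup.mp
    (hN.sup_eq_top ▸ Submodule.mem_top :
      (⟨x, Ideal.mem_span_singleton_self x⟩ : Ideal.span {x}) ∈ N ⊔ N')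
  have hab' : (a : Λ) + b = x := congrArg Subtype.val hab
  have zero (y : Ideal.span {x}) (h : y ∈ N) (h' : y ∈ N') : y = 0 := by
    have : y ∈ N ⊓ N' := ⟨h, h'⟩
    rwa [hN.inf_eq_bot, Submodule.mem_bot] at this
  -- The left side lies in `N'` and the right side in `N`, so both are zero: this one equation gives
  -- `ab = 0` and `a² = a`.
  have e₁ : (a : Λ) • b = a - (a : Λ) • a := by
    ext
    have := (congrArg ((a : Λ) * ·) hab').trans (mulx a)
    simp only [mul_add] at this
    exact eq_sub_of_add_eq' this
  have e₂ : (b : Λ) • a = b - (b : Λ) • b := by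
    ext
    have := (congrArg ((b : Λ) * ·) hab').trans (mulx b)
    simp only [mul_add] at this
    exact eq_sub_of_add_eq this
  have z₁ := zero _ (e₁ ▸ N.sub_mem ha (N.smul_mem _ ha)) (N'.smul_mem _ hb)
  have z₂ := zero _ (N.smul_mem _ ha) (e₂ ▸ N'.sub_mem hb (N'.smul_mem _ hb))
  rw [z₁] at e₁
  rw [z₂] at e₂
  have i₁ := congrArg Subtype.val (sub_eq_zero.mp e₁.symm)
  have i₂ := congrArg Subtype.val (sub_eq_zero.mp e₂.symm)
  rcases hx.2.2 a b i₁.symm i₂.symm (congrArg Subtype.val z₁) (congrArg Subtype.val z₂)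
    hab'.symm with h | h
  · left
    have h : a = 0 := Subtype.ext h
    rw [h, zero_add] at hab
    simpa [gen N' (hab ▸ hb)] using hN.inf_eq_bot
  · right
    have h : b = 0 := Subtype.ext h
    rw [h, add_zero] at hab
    simpa [gen N (hab ▸ ha)] using hN.inf_eq_bot

/-- The annihilator of a module is a two-sided ideal. -/
theorem span_le_of_smul_eq_zero {V : Type*} [AddCommGroup V] [Module Λ V] {x : Λ}
    (hx : ∀ v : V, x • v = 0) {a : Λ} (ha : a ∈ TwoSidedIdeal.span {x}) (v : V) : a • v = 0 := by
  have hle : TwoSidedIdeal.span {x} ≤ (Module.annihilator Λ V).toTwoSided := by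
    rw [TwoSidedIdeal.span_le, Set.singleton_subset_iff]
    exact Ideal.mem_toTwoSided.mpr (Module.mem_annihilator.mpr hx)
  exact Module.mem_annihilator.mp (Ideal.mem_toTwoSided.mp (hle ha)) v

end Idempotents

/-! ### The ideals `Λ ε Λ` and the primitive idempotents in them -/

section StageIdeal

variable {Λ : Type u} [Ring Λ] {n : ℕ} {e : Fin n → Λ} {Δ : ℕ → Finset (Fin n)} {i : ℕ}

theorem mem_usedBefore_succ {j : Fin n} :
    j ∈ usedBefore Δ (i + 1) ↔ j ∈ usedBefore Δ i ∨ j ∈ Δ i := by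
  simp [usedBefore, Finset.range_add_one, or_comm]

theorem mem_stageIdeal_of_mem (he : OrthogonalIdempotents e) {j : Fin n}
    (hj : j ∈ usedBefore Δ i) : e j ∈ stageIdeal e Δ i := by
  have h := (stageIdeal e Δ i).mul_mem_left (e j) _
    (TwoSidedIdeal.subset_span (Set.mem_singleton _))
  rwa [he.mul_sum_of_mem hj] at h

theorem stageIdeal_le {I : TwoSidedIdeal Λ} (h : ∀ j ∈ usedBefore Δ i, e j ∈ I) :
    stageIdeal e Δ i ≤ I := by
  rw [stageIdeal, TwoSidedIdeal.span_le, Set.singleton_subset_iff]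
  exact sum_mem h

theorem smul_eq_zero_of_mem_stageIdeal {V : Type*} [AddCommGroup V] [Module Λ V]
    (h : ∀ j ∈ usedBefore Δ i, ∀ v : V, e j • v = 0) {a : Λ} (ha : a ∈ stageIdeal e Δ i) (v : V) :
    a • v = 0 :=
  span_le_of_smul_eq_zero (fun v => by
    rw [Finset.sum_smul]
    exact Finset.sum_eq_zero fun j hj => h j hj v) ha v

/-- A primitive idempotent lies in the ideal generated by some of the `e j` exactly if it generates
a projective module isomorphic to that of one of them. -/
theorem mem_stageIdeal_iff_exists_isoProj [IsArtinianRing Λ] [IsNoetherianRing Λ]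
    (he : OrthogonalIdempotents e)
    (hprim : ∀ j, IsPrimitiveIdempotent (e j)) (j : Fin n) :
    e j ∈ stageIdeal e Δ i ↔ ∃ a ∈ usedBefore Δ i, IsoProj e a j := by
  constructor
  · intro hj
    have := (hprim j).nontrivial
    have := projective_span_singleton (hprim j).1
    -- If no `Λ(e a)` is isomorphic to `Λ(e j)`, no map between them is onto, so all of them land in
    -- `N₀`. Then each `e a`, and with them the ideal, kills the quotient by `N₀`, whereas `e j`
    -- does not.
    obtain ⟨N₀, hN₀, hmax⟩ := (hprim j).hasNoDecomposition.exists_greatest_proper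
    by_contra! hno
    have hle (a : Fin n) (ha : a ∈ usedBefore Δ i) (f : Ideal.span {e a} →ₗ[Λ] Ideal.span {e j}) :
        LinearMap.range f ≤ N₀ := by
      refine hmax _ fun htop => hno a ha ⟨LinearEquiv.ofBijective f
        ((hprim a).hasNoDecomposition.bijective_of_surjective (LinearMap.range_eq_top.mp htop))⟩
    have hz : ∀ a ∈ usedBefore Δ i, ∀ v : Ideal.span {e j} ⧸ N₀, e a • v = 0 := by
      intro a ha v
      obtain ⟨y, rfl⟩ := N₀.mkQ_surjective v
      rw [← map_smul, Submodule.mkQ_apply, Submodule.Quotient.mk_eq_zero]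
      exact hle a ha (LinearMap.toSpanSingleton Λ _ y ∘ₗ Submodule.subtype _)
        ⟨⟨e a, Ideal.mem_span_singleton_self _⟩, rfl⟩
    have hmem := smul_eq_zero_of_mem_stageIdeal hz hj
      (N₀.mkQ ⟨e j, Ideal.mem_span_singleton_self _⟩)
    rw [← map_smul, Submodule.mkQ_apply, Submodule.Quotient.mk_eq_zero] at hmem
    refine hN₀ (eq_top_iff.mpr ?_)
    rintro ⟨y, hy⟩ -
    obtain ⟨a, rfl⟩ := Ideal.mem_span_singleton'.mp hy
    have := N₀.smul_mem a hmem
    convert this using 1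
    ext
    simp [(hprim j).1.eq]
  · rintro ⟨a, ha, ⟨f⟩⟩
    -- Writing `e j = f (r * e a) = (r * e a) * f (e a)` exhibits it as an element of the ideal.
    obtain ⟨⟨x, hx⟩, hfx⟩ := f.surjective ⟨e j, Ideal.mem_span_singleton_self _⟩
    obtain ⟨r, rfl⟩ := Ideal.mem_span_singleton'.mp hx
    have h1 : (⟨r * e a, hx⟩ : Ideal.span {e a}) =
        (r * e a) • ⟨e a, Ideal.mem_span_singleton_self _⟩ := by
      ext
      simp [mul_assoc, (hprim a).1.eq]
    rw [h1, map_smul] at hfx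
    have h2 := congrArg Subtype.val hfx
    simp only [Submodule.coe_smul, smul_eq_mul] at h2
    rw [← h2]
    exact (stageIdeal e Δ i).mul_mem_right _ _
      ((stageIdeal e Δ i).mul_mem_left _ _ (mem_stageIdeal_of_mem he ha))

end StageIdeal

end TorsionDecomposition

namespace TorsionDecomposition

/-! ### The modules `D(xR)` -/

section Dual

variable {k : Type u} [CommRing k] {E : Type u} [AddCommGroup E] [Module k E]

/-- Over an artinian ring, an injective envelope of `k / rad k` is a cogenerator. -/
theorem IsInjectiveEnvelope.exists_apply_ne_zero [IsArtinianRing k]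
    (hE : IsInjectiveEnvelope k (k ⧸ Ring.jacobson k) E) {V : Type u} [AddCommGroup V] [Module k V]
    {v : V} (hv : v ≠ 0) : ∃ g : V →ₗ[k] E, g v ≠ 0 := by
  obtain ⟨hinj, ι, hι, -⟩ := hE
  have hne : LinearMap.ker (LinearMap.toSpanSingleton k V v) ≠ ⊤ := by
    rw [Ideal.ne_top_iff_one]
    simpa using hv
  obtain ⟨𝔪, h𝔪, hle⟩ := Ideal.exists_le_maximal _ hne
  -- The module `kv ≅ k / ann v` maps onto `k / 𝔪`, which embeds into the semisimple module `k / rad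
  -- k` and so into `E`. Injectivity of `E` extends the composite to `V`.
  have : IsSemisimpleModule k (k ⧸ Ring.jacobson k) := by
    rw [IsArtinian.isSemisimpleModule_iff_jacobson]
    exact Module.jacobson_quotient_jacobson k k
  have hrad : Ring.jacobson k ≤ 𝔪 := sInf_le (Ideal.isMaximal_def.mp h𝔪)
  obtain ⟨s, hs⟩ := IsSemisimpleModule.lifting_property (Submodule.factor hrad)
    (Submodule.factor_surjective hrad) LinearMap.id
  have hs' (x : k ⧸ 𝔪) : Submodule.factor hrad (s x) = x := LinearMap.congr_fun hs x
  let π : k →ₗ[k] E := ι ∘ₗ s ∘ₗ Submodule.mkQ 𝔪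
  have hπ : π 1 ≠ 0 := by
    intro h
    have h1 : s (Submodule.mkQ 𝔪 1) = 0 := hι (by simpa [π] using h)
    have h2 := hs' (Submodule.mkQ 𝔪 1)
    rw [h1, map_zero] at h2
    exact h𝔪.ne_top ((Ideal.eq_top_iff_one _).mpr ((Submodule.Quotient.mk_eq_zero 𝔪).mp h2.symm))
  let K := LinearMap.ker (LinearMap.toSpanSingleton k V v)
  obtain ⟨g, hg⟩ := hinj.out (K.liftQ (LinearMap.toSpanSingleton k V v) le_rfl)
    (LinearMap.ker_eq_bot.mp (Submodule.ker_liftQ_eq_bot _ _ _ le_rfl))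
    (K.liftQ π (fun x hx => by
      have : Submodule.mkQ 𝔪 x = 0 := (Submodule.Quotient.mk_eq_zero 𝔪).mpr (hle hx)
      simp [π, this]))
  refine ⟨g, ?_⟩
  have := hg (K.mkQ 1)
  simp only [Submodule.mkQ_apply, Submodule.liftQ_apply, LinearMap.toSpanSingleton_apply,
    one_smul] at this
  rwa [this]

variable {R : Type u} [Ring R] [Algebra k R]

theorem mem_rightIdeal (x a : R) : x * a ∈ rightIdeal k x := ⟨a, rfl⟩

/-- The homomorphism `M → D(xR)` that corresponds to a `k`-linear map `g : M → E`. -/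
def DualRight.lift (x : R) {M : Type*} [AddCommGroup M] [Module R M] (g : M →+ E)
    (hg : ∀ (c : k) (m : M), g (algebraMap k R c • m) = c • g m) : M →ₗ[R] DualRight k E x where
  toFun m := show rightIdeal k x →ₗ[k] E from
    { toFun := fun y => g ((y : R) • m)
      map_add' := fun y z => by simp [add_smul]
      map_smul' := fun c y => by
        rw [Submodule.coe_smul, Algebra.smul_def, mul_smul, hg]
        rfl }
  map_add' m m' := DualRight.ext fun y =>
    (congrArg g (smul_add (y : R) m m')).trans (map_add g _ _)
  map_smul' a m := DualRight.ext fun y => congrArg g (smul_smul (y : R) a m)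

/-- Evaluation at a fixed element, as an additive map. -/
def DualRight.eval {x : R} (y : rightIdeal k x) : DualRight k E x →+ E where
  toFun φ := φ y
  map_zero' := rfl
  map_add' _ _ := rfl

theorem DualRight.eval_algebraMap_smul {x : R} (y : rightIdeal k x) (c : k)
    (φ : DualRight k E x) :
    DualRight.eval y (algebraMap k R c • φ) = c • DualRight.eval y φ := by
  have h : rightMul k x (algebraMap k R c) y = c • y := by
    ext
    simp [Algebra.smul_def, Algebra.commutes]
  change φ (rightMul k x (algebraMap k R c) y) = c • φ y
  rw [h]
  exact LinearMap.map_smul (φ : rightIdeal k x →ₗ[k] E) c y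

/-- By adjunction `Hom_R(M, D(xR))` is `Hom_k(xM, E)`, and `E` is a cogenerator. -/
theorem smul_eq_zero_of_hom_dualRight [IsArtinianRing k]
    (hE : IsInjectiveEnvelope k (k ⧸ Ring.jacobson k) E) {x : R} (hx : IsIdempotentElem x)
    {M : Type u} [AddCommGroup M] [Module R M] (h : ∀ f : M →ₗ[R] DualRight k E x, f = 0) (m : M) :
    x • m = 0 := by
  let _ : Module k M := Module.compHom M (algebraMap k R)
  by_contra hne
  obtain ⟨g, hg⟩ := hE.exists_apply_ne_zero hne
  have := h (DualRight.lift x g.toAddMonoidHom fun c m => g.map_smul c m)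
  have := congrArg (fun φ : DualRight k E x => φ ⟨x, x, hx.eq⟩) (LinearMap.congr_fun this m)
  exact hg this

/-- The value of `f m` at `x * a` is that of `f (x • a • m)` at `x`. -/
theorem hom_dualRight_eq_zero {x : R} (hx : IsIdempotentElem x)
    {M : Type*} [AddCommGroup M] [Module R M] (h : ∀ m : M, x • m = 0)
    (f : M →ₗ[R] DualRight k E x) : f = 0 := by
  refine LinearMap.ext fun m => DualRight.ext ?_
  rintro ⟨_, a, rfl⟩
  have h1 : (⟨x * a, mem_rightIdeal x a⟩ : rightIdeal k x) =
      rightMul k x (x * a) ⟨x, x, hx.eq⟩ := by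
    ext
    simp [← mul_assoc, hx.eq]
  change f m ⟨x * a, mem_rightIdeal x a⟩ = 0
  rw [h1, ← DualRight.smul_apply, mul_smul, ← map_smul, ← map_smul, h, map_zero]
  rfl

/-- A map into `D(xR)` is determined by its values at `x`, which form a `k`-linear map to `E`. That
map extends over `k`, and the extension lifts back to `D(xR)`. -/
theorem injective_dualRight (hE : Module.Injective k E) {x : R} (hx : IsIdempotentElem x) :
    Module.Injective R (DualRight k E x) := by
  constructor
  intro X Y _ _ _ _ f hf g
  let _ : Module k X := Module.compHom X (algebraMap k R)
  let _ : Module k Y := Module.compHom Y (algebraMap k R)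
  let y₀ : rightIdeal k x := ⟨x, x, hx.eq⟩
  let f' : X →ₗ[k] Y :=
    { f.toAddMonoidHom with map_smul' := fun c m => f.map_smul (algebraMap k R c) m }
  let g' : X →ₗ[k] E :=
    { (DualRight.eval y₀).comp g.toAddMonoidHom with
      map_smul' := fun c m => by
        refine (congrArg (DualRight.eval y₀) (g.map_smul (algebraMap k R c) m)).trans ?_
        exact DualRight.eval_algebraMap_smul y₀ c (g m) }
  obtain ⟨h, hh⟩ := hE.out f' hf g'
  refine ⟨DualRight.lift x h.toAddMonoidHom fun c m => h.map_smul c m, fun m => ?_⟩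
  refine DualRight.ext ?_
  rintro ⟨_, a, rfl⟩
  have h1 : rightMul k x (x * a) y₀ = ⟨x * a, mem_rightIdeal x a⟩ := by
    ext
    simp [y₀, ← mul_assoc, hx.eq]
  change h ((x * a) • f m) = g m ⟨x * a, mem_rightIdeal x a⟩
  rw [← f.map_smul, ← h1, ← DualRight.smul_apply, ← g.map_smul]
  exact hh _

end Dual

/-! ### Closure properties of torsion pairs; modules over quotient algebras -/

section TorsionPairs

variable {Λ : Type u} [Ring Λ] {T F : ObjectProperty (ModuleCat.{u} Λ)}

/-- The composite of `f` with the projection of `Y` to its torsion-free part is zero and onto, so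
`Y` is its own torsion part. -/
theorem IsTorsionPair.torsion_of_surjective (h : IsTorsionPair (fgModules Λ) T F)
    {X Y : ModuleCat.{u} Λ} (hX : T X) (f : X →ₗ[Λ] Y) (hf : Function.Surjective f) : T Y := by
  have : Module.Finite Λ X := h.torsion_le _ hX
  obtain ⟨A, B, a, b, hA, hB, ha, hab, hb⟩ := h.exists_exact Y (Module.Finite.of_surjective f hf)
  have hbf := h.hom_eq_zero X B hX hB (b ∘ₗ f)
  have hb0 (y : Y) : b y = 0 := by
    obtain ⟨x, rfl⟩ := hf y
    exact LinearMap.congr_fun hbf x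
  have := h.torsion_iso
  exact T.prop_of_iso (LinearEquiv.ofBijective a ⟨ha, fun y => (hab y).mp (hb0 y)⟩).toModuleIso hA

/-- Dual to the quotient case; noetherianity makes `X` finitely generated, so that it has a
canonical sequence at all. -/
theorem IsTorsionPair.torsionFree_of_injective [IsNoetherianRing Λ]
    (h : IsTorsionPair (fgModules Λ) T F) {X Y : ModuleCat.{u} Λ} (hY : F Y) (f : X →ₗ[Λ] Y)
    (hf : Function.Injective f) : F X := by
  have : Module.Finite Λ Y := h.torsionFree_le _ hY
  obtain ⟨A, B, a, b, hA, hB, ha, hab, hb⟩ := h.exists_exact X (Module.Finite.of_injective f hf)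
  have hfa := h.hom_eq_zero A Y hA hY (f ∘ₗ a)
  have ha0 (x : A) : a x = 0 := hf (by simpa using LinearMap.congr_fun hfa x)
  have := h.torsionFree_iso
  refine F.prop_of_iso (LinearEquiv.ofBijective b ⟨?_, hb⟩).symm.toModuleIso hB
  rw [injective_iff_map_eq_zero]
  intro x hx
  obtain ⟨z, rfl⟩ := (hab x).mp hx
  exact ha0 z

theorem self_mem_addClosure (P : ModuleCat.{u} Λ) : addClosure P P :=
  ⟨1, LinearMap.pi fun _ => LinearMap.id, LinearMap.proj 0, rfl⟩

/-- A map to a `Λ/J`-module that is compatible with the actions, as a `Λ`-linear map. -/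
noncomputable def homToRestrict (J : TwoSidedIdeal Λ) {M : Type*} [AddCommGroup M] [Module Λ M]
    (N : ModuleCat.{u} (Λ ⧸ J.asIdeal)) (f : M →+ N)
    (hf : ∀ (a : Λ) (m : M), f (a • m) = Ideal.Quotient.mk J.asIdeal a • f m) :
    M →ₗ[Λ] restrict J N where
  toFun m := f m
  map_add' := f.map_add
  map_smul' := hf

/-- A map from a `Λ/J`-module that is compatible with the actions, as a `Λ`-linear map. -/
noncomputable def homOfRestrict (J : TwoSidedIdeal Λ) {M : Type*} [AddCommGroup M] [Module Λ M]
    (N : ModuleCat.{u} (Λ ⧸ J.asIdeal)) (f : N →+ M)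
    (hf : ∀ (a : Λ) (m : N), f (Ideal.Quotient.mk J.asIdeal a • m) = a • f m) :
    restrict J N →ₗ[Λ] M where
  toFun m := f m
  map_add' := f.map_add
  map_smul' := hf

theorem restrict_smul_eq_zero {J : TwoSidedIdeal Λ} {N : ModuleCat.{u} (Λ ⧸ J.asIdeal)} {a : Λ}
    (ha : a ∈ J) (m : restrict J N) : a • m = 0 := by
  change Ideal.Quotient.mk J.asIdeal a • (show N from m) = 0
  rw [Ideal.Quotient.eq_zero_iff_mem.mpr (TwoSidedIdeal.mem_asIdeal.mpr ha), zero_smul]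

theorem finite_restrict {J : TwoSidedIdeal Λ} {N : ModuleCat.{u} (Λ ⧸ J.asIdeal)}
    (hN : Module.Finite (Λ ⧸ J.asIdeal) N) : Module.Finite Λ (restrict J N) := by
  obtain ⟨s, hs⟩ := hN.fg_top
  let s' : Finset (restrict J N) := s
  have key (x : N) (hx : x ∈ Submodule.span (Λ ⧸ J.asIdeal) (s : Set N)) :
      (show restrict J N from x) ∈ Submodule.span Λ (s' : Set (restrict J N)) := by
    induction hx using Submodule.span_induction with
    | mem y hy => exact Submodule.subset_span hy
    | zero => exact Submodule.zero_mem _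
    | add y z _ _ hy hz => exact Submodule.add_mem _ hy hz
    | smul c y _ hy =>
      obtain ⟨a, rfl⟩ := Ideal.Quotient.mk_surjective c
      exact Submodule.smul_mem (Submodule.span Λ (s' : Set (restrict J N))) a hy
  exact ⟨⟨s', eq_top_iff.mpr fun x _ => key x (hs ▸ Submodule.mem_top)⟩⟩

theorem finite_of_finite_restrict {J : TwoSidedIdeal Λ} {N : ModuleCat.{u} (Λ ⧸ J.asIdeal)}
    (hN : Module.Finite Λ (restrict J N)) : Module.Finite (Λ ⧸ J.asIdeal) N := by
  obtain ⟨s, hs⟩ := hN.fg_top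
  let s' : Finset N := s
  have key (x : restrict J N) (hx : x ∈ Submodule.span Λ (s : Set (restrict J N))) :
      (show N from x) ∈ Submodule.span (Λ ⧸ J.asIdeal) (s' : Set N) := by
    induction hx using Submodule.span_induction with
    | mem y hy => exact Submodule.subset_span hy
    | zero => exact Submodule.zero_mem _
    | add y z _ _ hy hz => exact Submodule.add_mem _ hy hz
    | smul a y _ hy =>
      exact Submodule.smul_mem (Submodule.span (Λ ⧸ J.asIdeal) (s' : Set N))
        (Ideal.Quotient.mk J.asIdeal a) hy
  exact ⟨⟨s', eq_top_iff.mpr fun x _ => key x (hs ▸ Submodule.mem_top)⟩⟩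

theorem quotModules_iff {J : TwoSidedIdeal Λ} {M : ModuleCat.{u} Λ} :
    quotModules J M ↔ Module.Finite Λ M ∧ ∀ a ∈ J, ∀ m : M, a • m = 0 := by
  constructor
  · rintro ⟨N, hN, ⟨i⟩⟩
    let ψ : M ≃ₗ[Λ] restrict J N := i.toLinearEquiv
    have := finite_restrict hN
    refine ⟨Module.Finite.equiv ψ.symm, fun a ha m => ψ.injective ?_⟩
    rw [map_smul, map_zero, restrict_smul_eq_zero ha]
  · rintro ⟨hfin, hM⟩
    have ht : Module.IsTorsionBySet Λ M J.asIdeal := fun {m} a => hM a a.2 m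
    let _ := ht.module
    have : IsScalarTower Λ (Λ ⧸ J.asIdeal) M := ht.isScalarTower
    exact ⟨ModuleCat.of (Λ ⧸ J.asIdeal) M, Module.Finite.of_restrictScalars_finite Λ _ _,
      ⟨(LinearEquiv.ofBijective (homToRestrict J (ModuleCat.of (Λ ⧸ J.asIdeal) M)
        (AddMonoidHom.id M) fun _ _ => rfl) Function.bijective_id).toModuleIso⟩⟩

/-- The homomorphism from the left ideal `(Λ/J)x` to a module killed by `J` given by an element. -/
noncomputable def cyclicHom {J : TwoSidedIdeal Λ} (x : Λ) {M : Type*} [AddCommGroup M] [Module Λ M]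
    (hM : ∀ a ∈ J, ∀ m : M, a • m = 0) (m : M) :
    restrict J (ModuleCat.of (Λ ⧸ J.asIdeal) (Ideal.span {Ideal.Quotient.mk J.asIdeal x}))
      →ₗ[Λ] M :=
  have ht : Module.IsTorsionBySet Λ M J.asIdeal := fun {m} a => hM a a.2 m
  let _ := ht.module
  homOfRestrict J _ ((LinearMap.toSpanSingleton (Λ ⧸ J.asIdeal) M m) ∘ₗ
    Submodule.subtype (Ideal.span {Ideal.Quotient.mk J.asIdeal x})).toAddMonoidHom fun a y =>
      ((LinearMap.toSpanSingleton (Λ ⧸ J.asIdeal) M m) ∘ₗ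
        Submodule.subtype (Ideal.span {Ideal.Quotient.mk J.asIdeal x})).map_smul
          (Ideal.Quotient.mk J.asIdeal a) y

theorem cyclicHom_mk {J : TwoSidedIdeal Λ} (x : Λ) {M : Type*} [AddCommGroup M] [Module Λ M]
    (hM : ∀ a ∈ J, ∀ m : M, a • m = 0) (m : M) (a : Λ)
    (h : Ideal.Quotient.mk J.asIdeal a ∈ Ideal.span {Ideal.Quotient.mk J.asIdeal x}) :
    cyclicHom x hM m (⟨Ideal.Quotient.mk J.asIdeal a, h⟩ :
      Ideal.span {Ideal.Quotient.mk J.asIdeal x}) = a • m := rfl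

/-- For `J ≤ J'`, the module `(Λ/J')x` is a quotient of `(Λ/J)x`. -/
theorem exists_surjective_span {J J' : TwoSidedIdeal Λ} (hJ : J ≤ J') {x : Λ}
    (hx : IsIdempotentElem x) :
    ∃ f : restrict J (ModuleCat.of (Λ ⧸ J.asIdeal)
        (Ideal.span {Ideal.Quotient.mk J.asIdeal x})) →ₗ[Λ]
      restrict J' (ModuleCat.of (Λ ⧸ J'.asIdeal) (Ideal.span {Ideal.Quotient.mk J'.asIdeal x})),
      Function.Surjective f := by
  let x₀ : restrict J' (ModuleCat.of (Λ ⧸ J'.asIdeal)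
      (Ideal.span {Ideal.Quotient.mk J'.asIdeal x})) :=
    ⟨Ideal.Quotient.mk J'.asIdeal x, Ideal.mem_span_singleton_self _⟩
  refine ⟨cyclicHom x (fun a ha => restrict_smul_eq_zero (hJ ha)) x₀, ?_⟩
  rintro ⟨y, hy⟩
  obtain ⟨a, rfl⟩ := Ideal.mem_span_singleton'.mp hy
  obtain ⟨a, rfl⟩ := Ideal.Quotient.mk_surjective a
  refine ⟨⟨Ideal.Quotient.mk _ (a * x), Ideal.mem_span_singleton'.mpr
    ⟨Ideal.Quotient.mk _ a, (map_mul _ _ _).symm⟩⟩, ?_⟩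
  refine (cyclicHom_mk _ _ _ _ _).trans (Subtype.ext ?_)
  change Ideal.Quotient.mk J'.asIdeal (a * x) * Ideal.Quotient.mk J'.asIdeal x =
    Ideal.Quotient.mk J'.asIdeal a * Ideal.Quotient.mk J'.asIdeal x
  rw [← map_mul, ← map_mul, mul_assoc, hx.eq]

theorem mem_of_subsingleton_span {J : TwoSidedIdeal Λ} {x : Λ}
    (h : Subsingleton (Ideal.span {Ideal.Quotient.mk J.asIdeal x})) : x ∈ J := by
  have := (Submodule.subsingleton_iff_eq_bot.mp h).le (Ideal.mem_span_singleton_self _)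
  exact TwoSidedIdeal.mem_asIdeal.mp (Ideal.Quotient.eq_zero_iff_mem.mp this)

end TorsionPairs

end TorsionDecomposition

namespace TorsionDecomposition

/-! ### The classes `T^i` and `F^i` as modules killed by idempotents -/

section Stages

variable {k : Type u} [CommRing k] {E : Type u} [AddCommGroup E] [Module k E]
  {Λ : Type u} [Ring Λ] [Algebra k Λ] {n : ℕ} {e : Fin n → Λ} {Δ : ℕ → Finset (Fin n)} {i : ℕ}

/-- The homomorphism from a module killed by `J` to `D(x(Λ/J))` given by a `k`-linear map to `E`. -/
noncomputable def homToDual {J : TwoSidedIdeal Λ} (x : Λ) {M : Type*} [AddCommGroup M] [Module Λ M]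
    (hM : ∀ a ∈ J, ∀ m : M, a • m = 0) (g : M →+ E)
    (hg : ∀ (c : k) (m : M), g (algebraMap k Λ c • m) = c • g m) :
    M →ₗ[Λ] restrict J (ModuleCat.of (Λ ⧸ J.asIdeal)
      (DualRight k E (Ideal.Quotient.mk J.asIdeal x))) :=
  have ht : Module.IsTorsionBySet Λ M J.asIdeal := fun {m} a => hM a a.2 m
  let _ := ht.module
  homToRestrict J _ (DualRight.lift (Ideal.Quotient.mk J.asIdeal x) g hg).toAddMonoidHom
    fun a m => (DualRight.lift (Ideal.Quotient.mk J.asIdeal x) g hg).map_smul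
      (Ideal.Quotient.mk J.asIdeal a) m

/-- The inclusion of a summand of `P_i`. -/
noncomputable def singleProj (e : Fin n → Λ) (Δ : ℕ → Finset (Fin n)) (i : ℕ) (j : Δ i) :
    restrict (stageIdeal e Δ i) (ModuleCat.of (StageAlg e Δ i)
      (Ideal.span {Ideal.Quotient.mk (stageIdeal e Δ i).asIdeal (e j)})) →ₗ[Λ]
      stageProj e Δ i := by
  classical
  exact homToRestrict _ _ (LinearMap.single (StageAlg e Δ i) (fun j : Δ i =>
    Ideal.span {Ideal.Quotient.mk (stageIdeal e Δ i).asIdeal (e j)}) j).toAddMonoidHom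
      fun a m => (LinearMap.single (StageAlg e Δ i) (fun j : Δ i =>
    Ideal.span {Ideal.Quotient.mk (stageIdeal e Δ i).asIdeal (e j)}) j).map_smul
      (Ideal.Quotient.mk _ a) m

/-- The projection to a summand of `P_i`. -/
noncomputable def projProj (e : Fin n → Λ) (Δ : ℕ → Finset (Fin n)) (i : ℕ) (j : Δ i) :
    stageProj e Δ i →ₗ[Λ] restrict (stageIdeal e Δ i) (ModuleCat.of (StageAlg e Δ i)
      (Ideal.span {Ideal.Quotient.mk (stageIdeal e Δ i).asIdeal (e j)})) :=
  homToRestrict _ _ (LinearMap.proj (R := StageAlg e Δ i) (φ := fun j : Δ i =>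
    Ideal.span {Ideal.Quotient.mk (stageIdeal e Δ i).asIdeal (e j)}) j).toAddMonoidHom
      fun _ _ => rfl

theorem projProj_surjective (j : Δ i) : Function.Surjective (projProj e Δ i j) := by
  classical
  intro y
  exact ⟨singleProj e Δ i j y, Pi.single_eq_same (M := fun j : Δ i =>
    Ideal.span {Ideal.Quotient.mk (stageIdeal e Δ i).asIdeal (e j)}) j y⟩

theorem sum_singleProj (x : stageProj e Δ i) :
    ∑ j, singleProj e Δ i j (projProj e Δ i j x) = x := by
  classical
  exact Finset.univ_sum_single (M := fun j : Δ i =>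
    Ideal.span {Ideal.Quotient.mk (stageIdeal e Δ i).asIdeal (e j)}) x

/-- For `M` over `Λ^i`, `Hom(Λ^i(e j), M)` is `(e j)M`. -/
theorem forall_hom_stageProj_eq_zero_iff (he : OrthogonalIdempotents e) {M : Type*}
    [AddCommGroup M] [Module Λ M] (hM : ∀ a ∈ stageIdeal e Δ i, ∀ m : M, a • m = 0) :
    (∀ f : stageProj e Δ i →ₗ[Λ] M, f = 0) ↔ ∀ j ∈ Δ i, ∀ m : M, e j • m = 0 := by
  constructor
  · intro h j hj m
    obtain ⟨y, hy⟩ := projProj_surjective (e := e) (⟨j, hj⟩ : Δ i)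
      ⟨Ideal.Quotient.mk _ (e j), Ideal.mem_span_singleton_self _⟩
    have := LinearMap.congr_fun (h (cyclicHom (e j) hM m ∘ₗ projProj e Δ i ⟨j, hj⟩)) y
    rw [LinearMap.comp_apply, hy] at this
    exact this
  · intro h f
    have key (j : Δ i) (y) : f (singleProj e Δ i j y) = 0 := by
      obtain ⟨y, hy⟩ := y
      obtain ⟨a, rfl⟩ := Ideal.mem_span_singleton'.mp hy
      obtain ⟨a, rfl⟩ := Ideal.Quotient.mk_surjective a
      let z : restrict (stageIdeal e Δ i) (ModuleCat.of (StageAlg e Δ i)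
          (Ideal.span {Ideal.Quotient.mk (stageIdeal e Δ i).asIdeal (e j)})) :=
        ⟨Ideal.Quotient.mk _ (e j), Ideal.mem_span_singleton_self _⟩
      have h1 : (show restrict (stageIdeal e Δ i) (ModuleCat.of (StageAlg e Δ i)
          (Ideal.span {Ideal.Quotient.mk (stageIdeal e Δ i).asIdeal (e j)})) from
          ⟨Ideal.Quotient.mk _ a * Ideal.Quotient.mk _ (e j), hy⟩) = a • e j • z := by
        refine Subtype.ext ?_
        change Ideal.Quotient.mk _ a * Ideal.Quotient.mk _ (e j) =
          Ideal.Quotient.mk _ a * (Ideal.Quotient.mk _ (e j) * Ideal.Quotient.mk _ (e j))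
        rw [← map_mul _ (e j), (he.idem j).eq]
      refine (congrArg (fun w => f (singleProj e Δ i j w)) h1).trans ?_
      simp only [map_smul, h j j.2, smul_zero]
    ext x
    rw [← sum_singleProj x, map_sum]
    exact Finset.sum_eq_zero fun j _ => key j _

variable (k E) in
/-- The inclusion of a summand of `I_i`. -/
noncomputable def singleInj (e : Fin n → Λ) (Δ : ℕ → Finset (Fin n)) (i : ℕ) (j : Δ i) :
    restrict (stageIdeal e Δ i) (ModuleCat.of (StageAlg e Δ i)
      (DualRight k E (Ideal.Quotient.mk (stageIdeal e Δ i).asIdeal (e j)))) →ₗ[Λ]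
      stageInj e k E Δ i := by
  classical
  exact homToRestrict _ _ (LinearMap.single (StageAlg e Δ i) (fun j : Δ i =>
    DualRight k E (Ideal.Quotient.mk (stageIdeal e Δ i).asIdeal (e j))) j).toAddMonoidHom
      fun a m => (LinearMap.single (StageAlg e Δ i) (fun j : Δ i =>
    DualRight k E (Ideal.Quotient.mk (stageIdeal e Δ i).asIdeal (e j))) j).map_smul
      (Ideal.Quotient.mk _ a) m

theorem singleInj_injective (j : Δ i) : Function.Injective (singleInj k E e Δ i j) := by
  classical
  exact Pi.single_injective (M := fun j : Δ i =>
    DualRight k E (Ideal.Quotient.mk (stageIdeal e Δ i).asIdeal (e j))) j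

theorem smul_eq_zero_of_hom_restrict_dualRight [IsArtinianRing k]
    (hE : IsInjectiveEnvelope k (k ⧸ Ring.jacobson k) E) {J : TwoSidedIdeal Λ} {x : Λ}
    (hx : IsIdempotentElem x) {M : Type u} [AddCommGroup M] [Module Λ M]
    (hM : ∀ a ∈ J, ∀ m : M, a • m = 0)
    (h : ∀ f : M →ₗ[Λ] restrict J (ModuleCat.of (Λ ⧸ J.asIdeal)
      (DualRight k E (Ideal.Quotient.mk J.asIdeal x))), f = 0) (m : M) : x • m = 0 := by
  have ht : Module.IsTorsionBySet Λ M J.asIdeal := fun {m} a => hM a a.2 m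
  let _ := ht.module
  refine smul_eq_zero_of_hom_dualRight hE (hx.map (Ideal.Quotient.mk J.asIdeal)) (fun f => ?_) m
  have := h (homToRestrict J (ModuleCat.of (Λ ⧸ J.asIdeal)
    (DualRight k E (Ideal.Quotient.mk J.asIdeal x))) f.toAddMonoidHom
      fun a m => f.map_smul (Ideal.Quotient.mk J.asIdeal a) m)
  exact LinearMap.ext fun m => LinearMap.congr_fun this m

/-- Here `Hom(M, D((e j)Λ^i))` is the dual of `(e j)M`, so the condition agrees with the one for
`P_i`. -/
theorem forall_hom_stageInj_eq_zero_iff [IsArtinianRing k]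
    (hE : IsInjectiveEnvelope k (k ⧸ Ring.jacobson k) E) (he : OrthogonalIdempotents e)
    {M : Type u} [AddCommGroup M] [Module Λ M]
    (hM : ∀ a ∈ stageIdeal e Δ i, ∀ m : M, a • m = 0) :
    (∀ f : M →ₗ[Λ] stageInj e k E Δ i, f = 0) ↔ ∀ j ∈ Δ i, ∀ m : M, e j • m = 0 := by
  constructor
  · intro h j hj
    refine smul_eq_zero_of_hom_restrict_dualRight hE (he.idem j) hM fun f => ?_
    ext m
    refine singleInj_injective (⟨j, hj⟩ : Δ i) ?_
    exact (LinearMap.congr_fun (h (singleInj k E e Δ i ⟨j, hj⟩ ∘ₗ f)) m).trans (map_zero _).symm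
  · intro h f
    have ht : Module.IsTorsionBySet Λ M (stageIdeal e Δ i).asIdeal := fun {m} a => hM a a.2 m
    let _ := ht.module
    let f' : M →ₗ[StageAlg e Δ i] ((j : Δ i) →
        DualRight k E (Ideal.Quotient.mk (stageIdeal e Δ i).asIdeal (e j))) :=
      { f.toAddMonoidHom with
        map_smul' := fun c m => by
          obtain ⟨a, rfl⟩ := Ideal.Quotient.mk_surjective c
          exact f.map_smul a m }
    refine LinearMap.ext fun m => ?_
    refine funext fun j => ?_
    exact LinearMap.congr_fun (hom_dualRight_eq_zero ((he.idem j).map (Ideal.Quotient.mk _))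
      (fun m => h j j.2 m) (LinearMap.proj j ∘ₗ f')) m

variable {T F : ObjectProperty (ModuleCat.{u} Λ)} {projStep : ℕ → Prop} {m : ℕ}

/-- The class that a step leaves alone by definition meets the new condition anyway, since `P_i ∈ T`
and `I_i ∈ F` force the relevant homomorphisms to vanish. This uses both classes at stage `i`, hence
the joint induction. -/
theorem stageTorsion_and_stageTorsionFree_iff [IsArtinianRing k]
    (hE : IsInjectiveEnvelope k (k ⧸ Ring.jacobson k) E) (he : OrthogonalIdempotents e)
    (hTF : IsTorsionPair (fgModules Λ) T F) (h : IsDecomposition e k E T F projStep m Δ)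
    (i : ℕ) (hi : i ≤ m + 1) :
    (∀ M, stageTorsion e T projStep Δ i M ↔
      T M ∧ ∀ j ∈ usedBefore Δ i, ∀ x : M, e j • x = 0) ∧
    (∀ M, stageTorsionFree e k E F projStep Δ i M ↔
      F M ∧ ∀ j ∈ usedBefore Δ i, ∀ x : M, e j • x = 0) := by
  induction i with
  | zero => simp [stageTorsion, stageTorsionFree, usedBefore]
  | succ i ih =>
    obtain ⟨ihT, ihF⟩ := ih (by omega)
    have hsplit (M : ModuleCat.{u} Λ) : (∀ j ∈ usedBefore Δ (i + 1), ∀ x : M, e j • x = 0) ↔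
        (∀ j ∈ usedBefore Δ i, ∀ x : M, e j • x = 0) ∧ ∀ j ∈ Δ i, ∀ x : M, e j • x = 0 := by
      simp only [mem_usedBefore_succ, or_imp, forall_and]
    have hkill {M : ModuleCat.{u} Λ} (hM : ∀ j ∈ usedBefore Δ i, ∀ x : M, e j • x = 0) :
        ∀ a ∈ stageIdeal e Δ i, ∀ x : M, a • x = 0 :=
      fun a ha x => smul_eq_zero_of_mem_stageIdeal hM ha x
    by_cases hp : projStep i
    · have hP : stageTorsion e T projStep Δ i (stageProj e Δ i) :=
        ((congrFun (h.proj_step i (by omega) hp) _).mpr (self_mem_addClosure _)).1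
      refine ⟨fun M => ?_, fun M => ?_⟩
      · rw [hsplit, ← and_assoc, ← ihT]
        refine and_congr_right fun hM => ?_
        rw [← forall_hom_stageProj_eq_zero_iff he (hkill ((ihT M).mp hM).2)]
        exact ⟨fun h => h hp, fun h _ => h⟩
      · rw [hsplit, ← and_assoc, ← ihF]
        refine and_congr_right fun hM => iff_of_true (fun h => (h hp).elim) ?_
        obtain ⟨hF, hM⟩ := (ihF M).mp hM
        rw [← forall_hom_stageProj_eq_zero_iff he (hkill hM)]
        exact hTF.hom_eq_zero _ _ ((ihT _).mp hP).1 hF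
    · have hI : stageTorsionFree e k E F projStep Δ i (stageInj e k E Δ i) :=
        ((congrFun (h.inj_step i (by omega) hp) _).mpr (self_mem_addClosure _)).1
      refine ⟨fun M => ?_, fun M => ?_⟩
      · rw [hsplit, ← and_assoc, ← ihT]
        refine and_congr_right fun hM => iff_of_true (fun h => (hp h).elim) ?_
        obtain ⟨hT, hM⟩ := (ihT M).mp hM
        rw [← forall_hom_stageInj_eq_zero_iff hE he (hkill hM)]
        exact hTF.hom_eq_zero _ _ hT ((ihF _).mp hI).1
      · rw [hsplit, ← and_assoc, ← ihF]
        refine and_congr_right fun hM => ?_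
        rw [← forall_hom_stageInj_eq_zero_iff hE he (hkill ((ihF M).mp hM).2)]
        exact ⟨fun h => h hp, fun h _ => h⟩

theorem torsion_stageProj [IsArtinianRing k]
    (hE : IsInjectiveEnvelope k (k ⧸ Ring.jacobson k) E) (he : OrthogonalIdempotents e)
    (hTF : IsTorsionPair (fgModules Λ) T F) (h : IsDecomposition e k E T F projStep m Δ)
    (hi : i ≤ m) (hp : projStep i) : T (stageProj e Δ i) :=
  (((stageTorsion_and_stageTorsionFree_iff hE he hTF h i (by omega)).1 _).mp
    ((congrFun (h.proj_step i hi hp) _).mpr (self_mem_addClosure _)).1).1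

theorem torsionFree_stageInj [IsArtinianRing k]
    (hE : IsInjectiveEnvelope k (k ⧸ Ring.jacobson k) E) (he : OrthogonalIdempotents e)
    (hTF : IsTorsionPair (fgModules Λ) T F) (h : IsDecomposition e k E T F projStep m Δ)
    (hi : i ≤ m) (hp : ¬ projStep i) : F (stageInj e k E Δ i) :=
  (((stageTorsion_and_stageTorsionFree_iff hE he hTF h i (by omega)).2 _).mp
    ((congrFun (h.inj_step i hi hp) _).mpr (self_mem_addClosure _)).1).1

/-- Maps between the modules `D(x(Λ/J'))` and `D(x(Λ/J))` for `J ≤ J'`. -/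
theorem exists_injective_dualRight {J J' : TwoSidedIdeal Λ} (hJ : J ≤ J') {x : Λ}
    (hx : IsIdempotentElem x) :
    ∃ f : restrict J' (ModuleCat.of (Λ ⧸ J'.asIdeal)
        (DualRight k E (Ideal.Quotient.mk J'.asIdeal x))) →ₗ[Λ]
      restrict J (ModuleCat.of (Λ ⧸ J.asIdeal) (DualRight k E (Ideal.Quotient.mk J.asIdeal x))),
      Function.Injective f := by
  have hx' := hx.map (Ideal.Quotient.mk J'.asIdeal)
  -- The map is dual to the projection `x(Λ/J) → x(Λ/J')`. It is built from evaluation at `x`, and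
  -- is injective because `(x * a) • φ` takes at `x` the value of `φ` at `x * a`.
  let y₀ : rightIdeal k (Ideal.Quotient.mk J'.asIdeal x) := ⟨_, _, hx'.eq⟩
  let g : restrict J' (ModuleCat.of (Λ ⧸ J'.asIdeal)
      (DualRight k E (Ideal.Quotient.mk J'.asIdeal x))) →+ E := DualRight.eval y₀
  refine ⟨homToDual x (fun a ha => restrict_smul_eq_zero (hJ ha)) g
    fun c φ => DualRight.eval_algebraMap_smul y₀ c φ, ?_⟩
  intro φ ψ hφψ
  refine DualRight.ext ?_
  rintro ⟨_, a, rfl⟩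
  obtain ⟨a, rfl⟩ := Ideal.Quotient.mk_surjective a
  have h1 : g ((x * a) • φ) = g ((x * a) • ψ) :=
    congrArg (fun θ : DualRight k E (Ideal.Quotient.mk J.asIdeal x) =>
      θ ⟨Ideal.Quotient.mk J.asIdeal x * Ideal.Quotient.mk J.asIdeal a, mem_rightIdeal _ _⟩) hφψ
  have h2 : rightMul k _ (Ideal.Quotient.mk J'.asIdeal (x * a)) y₀ =
      ⟨Ideal.Quotient.mk J'.asIdeal x * Ideal.Quotient.mk J'.asIdeal a, mem_rightIdeal _ _⟩ := by
    ext
    simp [y₀, ← mul_assoc, hx'.eq]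
  change DualRight.eval y₀ (Ideal.Quotient.mk J'.asIdeal (x * a) •
    (show DualRight k E (Ideal.Quotient.mk J'.asIdeal x) from φ)) =
    DualRight.eval y₀ (Ideal.Quotient.mk J'.asIdeal (x * a) •
    (show DualRight k E (Ideal.Quotient.mk J'.asIdeal x) from ψ)) at h1
  change (show DualRight k E (Ideal.Quotient.mk J'.asIdeal x) from φ)
    (rightMul k _ (Ideal.Quotient.mk J'.asIdeal (x * a)) y₀) =
    (show DualRight k E (Ideal.Quotient.mk J'.asIdeal x) from ψ)
    (rightMul k _ (Ideal.Quotient.mk J'.asIdeal (x * a)) y₀) at h1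
  rw [h2] at h1
  exact h1

/-- If the dual is zero, all maps from `Λ/J` to it vanish, so `x` kills the element `1` of `Λ/J`. -/
theorem mem_of_subsingleton_dualRight [IsArtinianRing k]
    (hE : IsInjectiveEnvelope k (k ⧸ Ring.jacobson k) E) {J : TwoSidedIdeal Λ} {x : Λ}
    (hx : IsIdempotentElem x)
    (h : Subsingleton (DualRight k E (Ideal.Quotient.mk J.asIdeal x))) : x ∈ J := by
  have := smul_eq_zero_of_hom_dualRight hE (hx.map (Ideal.Quotient.mk J.asIdeal))
    (M := Λ ⧸ J.asIdeal) (fun f => LinearMap.ext fun m => Subsingleton.elim _ _) 1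
  rw [smul_eq_mul, mul_one, Ideal.Quotient.eq_zero_iff_mem] at this
  exact TwoSidedIdeal.mem_asIdeal.mp this

/-- An idempotent whose projective module over the last algebra is torsion lies in the last
ideal. -/
theorem mem_stageIdeal_of_torsion [IsArtinianRing k]
    (hE : IsInjectiveEnvelope k (k ⧸ Ring.jacobson k) E) (he : OrthogonalIdempotents e)
    (hTF : IsTorsionPair (fgModules Λ) T F) (h : IsDecomposition e k E T F projStep m Δ)
    {x : Λ} (hx : IsIdempotentElem x)
    (hT : T (restrict (stageIdeal e Δ (m + 1)) (ModuleCat.of (StageAlg e Δ (m + 1))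
      (Ideal.span {Ideal.Quotient.mk (stageIdeal e Δ (m + 1)).asIdeal x})))) :
    x ∈ stageIdeal e Δ (m + 1) :=
  mem_of_subsingleton_span (h.residual_zero _ (Or.inl
    ⟨((stageTorsion_and_stageTorsionFree_iff hE he hTF h (m + 1) le_rfl).1 _).mpr
      ⟨hT, fun _ hj => restrict_smul_eq_zero (mem_stageIdeal_of_mem he hj)⟩,
      ModuleCat.of (StageAlg e Δ (m + 1))
        (Ideal.span {Ideal.Quotient.mk (stageIdeal e Δ (m + 1)).asIdeal x}),
      inferInstanceAs (Module.Finite (StageAlg e Δ (m + 1))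
        (Ideal.span {Ideal.Quotient.mk (stageIdeal e Δ (m + 1)).asIdeal x})),
      projective_span_singleton (hx.map _), ⟨Iso.refl _⟩⟩))

/-- An idempotent whose injective module over the last algebra is torsion-free lies in the last
ideal. -/
theorem mem_stageIdeal_of_torsionFree [IsArtinianRing k]
    (hE : IsInjectiveEnvelope k (k ⧸ Ring.jacobson k) E) (he : OrthogonalIdempotents e)
    (hTF : IsTorsionPair (fgModules Λ) T F) (h : IsDecomposition e k E T F projStep m Δ)
    {x : Λ} (hx : IsIdempotentElem x)
    (hF : F (restrict (stageIdeal e Δ (m + 1)) (ModuleCat.of (StageAlg e Δ (m + 1))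
      (DualRight k E (Ideal.Quotient.mk (stageIdeal e Δ (m + 1)).asIdeal x))))) :
    x ∈ stageIdeal e Δ (m + 1) := by
  -- Finite generation of the dual comes from its membership in `F`, not from a property of `E`.
  have hfin := hTF.torsionFree_le _ hF
  unfold fgModules at hfin
  exact mem_of_subsingleton_dualRight hE hx (h.residual_zero _ (Or.inr
    ⟨((stageTorsion_and_stageTorsionFree_iff hE he hTF h (m + 1) le_rfl).2 _).mpr
      ⟨hF, fun _ hj => restrict_smul_eq_zero (mem_stageIdeal_of_mem he hj)⟩,
      ModuleCat.of (StageAlg e Δ (m + 1))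
        (DualRight k E (Ideal.Quotient.mk (stageIdeal e Δ (m + 1)).asIdeal x)),
      finite_of_finite_restrict hfin, injective_dualRight hE.1 (hx.map _), ⟨Iso.refl _⟩⟩))

/-! ### Comparison of two decompositions -/

variable {projStep' : ℕ → Prop} {m' : ℕ} {Δ' : ℕ → Finset (Fin n)}

/-- The ideals of one decomposition are contained in the last ideal of any other one. -/
theorem stageIdeal_le_stageIdeal [IsArtinianRing k] [IsNoetherianRing Λ]
    (hE : IsInjectiveEnvelope k (k ⧸ Ring.jacobson k) E) (he : OrthogonalIdempotents e)
    (hTF : IsTorsionPair (fgModules Λ) T F) (h : IsDecomposition e k E T F projStep m Δ)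
    (h' : IsDecomposition e k E T F projStep' m' Δ') (i : ℕ) (hi : i ≤ m + 1) :
    stageIdeal e Δ i ≤ stageIdeal e Δ' (m' + 1) := by
  induction i with
  | zero => exact stageIdeal_le (by simp [usedBefore])
  | succ i ih =>
    have hle := ih (by omega)
    refine stageIdeal_le fun j hj => ?_
    rcases mem_usedBefore_succ.mp hj with hj | hj
    · exact hle (mem_stageIdeal_of_mem he hj)
    by_cases hp : projStep i
    -- The induction hypothesis `hle` makes `e j` over the last algebra of `Δ'` generate a quotient
    -- of a summand of `P_i`; in the injective case below, its dual module embeds into `I_i`.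
    · obtain ⟨f, hf⟩ := exists_surjective_span hle (he.idem j)
      exact mem_stageIdeal_of_torsion hE he hTF h' (he.idem j)
        (hTF.torsion_of_surjective (torsion_stageProj hE he hTF h (by omega) hp)
          (f ∘ₗ projProj e Δ i ⟨j, hj⟩) (hf.comp (projProj_surjective _)))
    · obtain ⟨f, hf⟩ := exists_injective_dualRight (k := k) (E := E) hle (he.idem j)
      have hinj := (singleInj_injective (k := k) (E := E) (e := e) (⟨j, hj⟩ : Δ i)).comp hf
      exact mem_stageIdeal_of_torsionFree hE he hTF h' (he.idem j)
        (hTF.torsionFree_of_injective (torsionFree_stageInj hE he hTF h (by omega) hp)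
          (singleInj k E e Δ i ⟨j, hj⟩ ∘ₗ f) hinj)

/-- The canonical sequence of a module killed by the ideal has ends killed by it, being a submodule
and a quotient. -/
theorem isTorsionPair_residual [IsArtinianRing k] [IsNoetherianRing Λ]
    (hE : IsInjectiveEnvelope k (k ⧸ Ring.jacobson k) E) (he : OrthogonalIdempotents e)
    (hTF : IsTorsionPair (fgModules Λ) T F) (h : IsDecomposition e k E T F projStep m Δ) :
    IsTorsionPair (quotModules (stageIdeal e Δ (m + 1))) (stageTorsion e T projStep Δ (m + 1))
      (stageTorsionFree e k E F projStep Δ (m + 1)) := by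
  obtain ⟨hT, hF⟩ := stageTorsion_and_stageTorsionFree_iff hE he hTF h (m + 1) le_rfl
  have hiso {X Y : ModuleCat.{u} Λ} (i : X ≅ Y)
      (hX : ∀ j ∈ usedBefore Δ (m + 1), ∀ x : X, e j • x = 0) :
      ∀ j ∈ usedBefore Δ (m + 1), ∀ x : Y, e j • x = 0 := by
    intro j hj y
    obtain ⟨x, rfl⟩ := i.toLinearEquiv.surjective y
    rw [← map_smul, hX j hj, map_zero]
  have := hTF.torsion_iso
  have := hTF.torsionFree_iso
  refine ⟨fun M hM => ?_, fun M hM => ?_, ⟨fun i hX => ?_⟩, ⟨fun i hX => ?_⟩, ?_, ?_⟩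
  · obtain ⟨h1, h2⟩ := (hT M).mp hM
    exact quotModules_iff.mpr ⟨hTF.torsion_le _ h1,
      fun a ha x => smul_eq_zero_of_mem_stageIdeal h2 ha x⟩
  · obtain ⟨h1, h2⟩ := (hF M).mp hM
    exact quotModules_iff.mpr ⟨hTF.torsionFree_le _ h1,
      fun a ha x => smul_eq_zero_of_mem_stageIdeal h2 ha x⟩
  · exact (hT _).mpr ⟨T.prop_of_iso i ((hT _).mp hX).1, hiso i ((hT _).mp hX).2⟩
  · exact (hF _).mpr ⟨F.prop_of_iso i ((hF _).mp hX).1, hiso i ((hF _).mp hX).2⟩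
  · exact fun X Y hX hY => hTF.hom_eq_zero X Y ((hT X).mp hX).1 ((hF Y).mp hY).1
  · intro X hX
    obtain ⟨hfin, hkill⟩ := quotModules_iff.mp hX
    obtain ⟨A, B, f, g, hA, hB, hf, hfg, hg⟩ := hTF.exists_exact X hfin
    refine ⟨A, B, f, g, (hT A).mpr ⟨hA, fun j hj x => hf ?_⟩, (hF B).mpr ⟨hB, fun j hj x => ?_⟩,
      hf, hfg, hg⟩
    · rw [map_smul, map_zero, hkill _ (mem_stageIdeal_of_mem he hj)]
    · obtain ⟨y, rfl⟩ := hg x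
      rw [← map_smul, hkill _ (mem_stageIdeal_of_mem he hj), map_zero]

/-- The residual torsion classes are those of the modules killed by the last ideal. -/
theorem stageTorsion_eq_of_stageIdeal_eq [IsArtinianRing k]
    (hE : IsInjectiveEnvelope k (k ⧸ Ring.jacobson k) E) (he : OrthogonalIdempotents e)
    (hTF : IsTorsionPair (fgModules Λ) T F) (h : IsDecomposition e k E T F projStep m Δ)
    (h' : IsDecomposition e k E T F projStep' m' Δ')
    (hJ : stageIdeal e Δ (m + 1) = stageIdeal e Δ' (m' + 1)) :
    stageTorsion e T projStep Δ (m + 1) = stageTorsion e T projStep' Δ' (m' + 1) ∧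
    stageTorsionFree e k E F projStep Δ (m + 1) =
      stageTorsionFree e k E F projStep' Δ' (m' + 1) := by
  obtain ⟨hT, hF⟩ := stageTorsion_and_stageTorsionFree_iff hE he hTF h (m + 1) le_rfl
  obtain ⟨hT', hF'⟩ := stageTorsion_and_stageTorsionFree_iff hE he hTF h' (m' + 1) le_rfl
  have key (M : ModuleCat.{u} Λ) : (∀ j ∈ usedBefore Δ (m + 1), ∀ x : M, e j • x = 0) ↔
      ∀ j ∈ usedBefore Δ' (m' + 1), ∀ x : M, e j • x = 0 :=
    ⟨fun hM j hj x => smul_eq_zero_of_mem_stageIdeal hM (hJ ▸ mem_stageIdeal_of_mem he hj) x,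
      fun hM j hj x => smul_eq_zero_of_mem_stageIdeal hM (hJ ▸ mem_stageIdeal_of_mem he hj) x⟩
  constructor <;> ext M
  · rw [hT, hT', key]
  · rw [hF, hF', key]

end Stages

end TorsionDecomposition

open TorsionDecomposition in
theorem theorem3p13 {k Λ E : Type u} [CommRing k] [IsArtinianRing k] [Ring Λ] [Algebra k Λ]
    [Module.Finite k Λ] [AddCommGroup E] [Module k E]
    (hE : IsInjectiveEnvelope k (k ⧸ Ring.jacobson k) E)
    {n : ℕ} (e : Fin n → Λ) (he : CompleteOrthogonalIdempotents e)
    (hprim : ∀ i, IsPrimitiveIdempotent (e i))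
    (T F : CategoryTheory.ObjectProperty (ModuleCat.{u} Λ))
    (hTF : IsTorsionPair (fgModules Λ) T F)
    (m₁ m₂ : ℕ) (Δ₁ Δ₂ : ℕ → Finset (Fin n))
    (h₁ : IsLeftDecomposition e k E T F m₁ Δ₁)
    (h₂ : IsRightDecomposition e k E T F m₂ Δ₂) :
    stageTorsion e T Even Δ₁ (m₁ + 1) = stageTorsion e T Odd Δ₂ (m₂ + 1) ∧
    stageTorsionFree e k E F Even Δ₁ (m₁ + 1) = stageTorsionFree e k E F Odd Δ₂ (m₂ + 1) ∧
    stageIdeal e Δ₁ (m₁ + 1) = stageIdeal e Δ₂ (m₂ + 1) ∧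
    IsTorsionPair (quotModules (stageIdeal e Δ₁ (m₁ + 1)))
      (stageTorsion e T Even Δ₁ (m₁ + 1)) (stageTorsionFree e k E F Even Δ₁ (m₁ + 1)) ∧
    (∀ j, (∃ a ∈ usedBefore Δ₁ (m₁ + 1), IsoProj e a j) ↔
      (∃ b ∈ usedBefore Δ₂ (m₂ + 1), IsoProj e b j)) ∧
    (IsoClosed e (usedBefore Δ₁ (m₁ + 1)) → IsoClosed e (usedBefore Δ₂ (m₂ + 1)) →
      usedBefore Δ₁ (m₁ + 1) = usedBefore Δ₂ (m₂ + 1)) := by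
  have : IsArtinianRing Λ := IsArtinianRing.of_finite k Λ
  have : IsNoetherianRing Λ := IsNoetherianRing.of_finite k Λ
  have ho := he.toOrthogonalIdempotents
  have hJ : stageIdeal e Δ₁ (m₁ + 1) = stageIdeal e Δ₂ (m₂ + 1) :=
    le_antisymm (stageIdeal_le_stageIdeal hE ho hTF h₁ h₂ _ le_rfl)
      (stageIdeal_le_stageIdeal hE ho hTF h₂ h₁ _ le_rfl)
  obtain ⟨hT, hF⟩ := stageTorsion_eq_of_stageIdeal_eq hE ho hTF h₁ h₂ hJ
  -- Both sides say that `e j` lies in the common last ideal; `usedBefore` at `m + 1` collects all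
  -- of `Δ 0, …, Δ m`.
  have hiff (j : Fin n) : (∃ a ∈ usedBefore Δ₁ (m₁ + 1), IsoProj e a j) ↔
      ∃ b ∈ usedBefore Δ₂ (m₂ + 1), IsoProj e b j := by
    rw [← mem_stageIdeal_iff_exists_isoProj ho hprim, hJ,
      mem_stageIdeal_iff_exists_isoProj ho hprim]
  refine ⟨hT, hF, hJ, isTorsionPair_residual hE ho hTF h₁, hiff, fun c₁ c₂ => ?_⟩
  ext j
  constructor
  · intro hj
    obtain ⟨b, hb, hbj⟩ := (hiff j).mp ⟨j, hj, ⟨LinearEquiv.refl _ _⟩⟩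
    exact c₂ b j hb hbj
  · intro hj
    obtain ⟨a, ha, haj⟩ := (hiff j).mpr ⟨j, hj, ⟨LinearEquiv.refl _ _⟩⟩
    exact c₁ a j ha haj
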